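/- Let $n\ge 4$ and let $\mathfrak n$ be a finite-dimensional complex simple Lie algebra of type $D_n$, with a Cartan subalgebra $\mathfrak h$ and simple roots $\alpha_1,\dots,\alpha_n$ numbered so that $\alpha_1-\alpha_2-\cdots-\alpha_{n-2}$ is a chain in the Dynkin diagram and both $\alpha_{n-1}$ and $\alpha_n$ are joined to $\alpha_{n-2}$. For a set $\Sigma$ of simple roots, the grading of $\mathfrak n$ associated to $\Sigma$ is $\mathfrak n=\bigoplus_{j\in\mathbb Z}\mathfrak n_j$, where $\mathfrak n_j$ is the sum of the root spaces $\mathfrak n_\alpha$ with $\mathrm{ht}_\Sigma(\alpha)=j$, together with $\mathfrak h$ if $j=0$; here $\mathrm{ht}_\Sigma\big(\sum_i a_i\alpha_i\big)=\sum_{\alpha_i\in\Sigma}a_i$. Suppose that $\Sigma$ is one of $$\Sigma_{1,i}=\{\alpha_1,\alpha_i\},\qquad \Sigma_{i,n}=\{\alpha_i,\alpha_n\},\qquad \Sigma_{i,n-1}=\{\alpha_i,\alpha_{n-1}\}\quad(2\le i\le n-2),\qquad \Sigma_{1,n-1,n}=\{\alpha_1,\alpha_{n-1},\alpha_n\},$$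 which are the sets whose associated grading is a $|3|$-grading $\mathfrak n=\mathfrak n_{-3}\oplus\cdots\oplus\mathfrak n_3$. For $r\ge 0$ let $\mathfrak F_{r,3}=\mathfrak f_{-3}\oplus\mathfrak f_{-2}\oplus\mathfrak f_{-1}$ be the free nilpotent complex Lie algebra of step $3$ on $r$ generators (the free Lie algebra modulo all brackets of length at least $4$), with its canonical grading, in which $\mathfrak f_{-m}$ is spanned by the iterated brackets of $m$ generators. Then for every $r$ there is no graded isomorphism between $\mathfrak F_{r,3}$ and $\mathfrak n_{-3}\oplus\mathfrak n_{-2}\oplus\mathfrak n_{-1}$, that is, no isomorphism of Lie algebras that maps $\mathfrak f_{j}$ onto $\mathfrak n_{j}$ for all $j<0$. -/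

import Mathlib

open Module

/-! ### Graded Lie algebras -/

section Graded

variable {R L M : Type*} [CommRing R] [LieRing L] [LieAlgebra R L] [LieRing M] [LieAlgebra R M]

/-- A Lie algebra isomorphism is a graded isomorphism from `(L, 𝒜)` to `(M, ℬ)` if it carries the
degree `j` component of `L` onto the degree `j` component of `M` for every `j : ℤ`. -/
def IsGradedIso (𝒜 : ℤ → Submodule R L) (ℬ : ℤ → Submodule R M) (φ : L ≃ₗ⁅R⁆ M) : Prop :=
  ∀ j : ℤ, (𝒜 j).map (φ.toLinearEquiv : L →ₗ[R] M) = ℬ j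

/-- The negative part `⨁_{j < 0} 𝒜 j` of a `ℤ`-graded Lie algebra, as a Lie subalgebra.
For a `|3|`-grading this is `𝒜 (-3) ⊕ 𝒜 (-2) ⊕ 𝒜 (-1)`. -/
def negativePart (𝒜 : ℤ → Submodule R L) [SetLike.GradedBracket 𝒜] : LieSubalgebra R L where
  toSubmodule := ⨆ (j : ℤ) (_ : j < 0), 𝒜 j
  lie_mem' := by
    intro x y hx hy
    simp only [AddSubsemigroup.mem_carrier, AddSubmonoid.mem_toSubsemigroup,
      Submodule.mem_toAddSubmonoid] at hx hy ⊢
    have key : ∀ (i : ℤ), i < 0 → ∀ u ∈ 𝒜 i, ∀ v ∈ (⨆ (j : ℤ) (_ : j < 0), 𝒜 j),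
        ⁅u, v⁆ ∈ (⨆ (j : ℤ) (_ : j < 0), 𝒜 j) := by
      intro i hi u hu
      suffices h : (⨆ (j : ℤ) (_ : j < 0), 𝒜 j) ≤
          (⨆ (j : ℤ) (_ : j < 0), 𝒜 j).comap (LieAlgebra.ad R L u : L →ₗ[R] L) by
        intro v hv
        exact h hv
      refine iSup₂_le fun j hj w hw => ?_
      exact Submodule.mem_iSup_of_mem (i + j) (Submodule.mem_iSup_of_mem (by omega)
        (SetLike.GradedBracket.bracket_mem hu hw))
    have h : (⨆ (j : ℤ) (_ : j < 0), 𝒜 j) ≤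
        (⨆ (j : ℤ) (_ : j < 0), 𝒜 j).comap (LieAlgebra.ad R L y : L →ₗ[R] L) := by
      refine iSup₂_le fun j hj w hw => ?_
      have := key j hj w hw y hy
      rw [← lie_skew, neg_mem_iff] at this
      exact this
    have := h hx
    rw [Submodule.mem_comap, LieAlgebra.ad_apply, ← lie_skew, neg_mem_iff] at this
    exact this

/-- The grading induced on the negative part of a `ℤ`-graded Lie algebra. -/
def negativeGrading (𝒜 : ℤ → Submodule R L) [SetLike.GradedBracket 𝒜] (j : ℤ) :
    Submodule R (negativePart 𝒜) :=
  (𝒜 j).comap (negativePart 𝒜).toSubmodule.subtype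

end Graded

/-! ### Free nilpotent Lie algebras -/

section FreeNilpotent

variable (R : Type*) [CommRing R]

/-- `IsLieMonomial R m x`: `x` is an iterated bracket (with any bracketing) of `m` of the free
generators. -/
inductive IsLieMonomial {X : Type*} : ℕ → FreeLieAlgebra R X → Prop
  | of (i : X) : IsLieMonomial 1 (FreeLieAlgebra.of R i)
  | lie {m n : ℕ} {x y : FreeLieAlgebra R X} (hx : IsLieMonomial m x) (hy : IsLieMonomial n y) :
      IsLieMonomial (m + n) ⁅x, y⁆

/-- The free nilpotent Lie algebra `𝔉_{r,k}` of step `k` on `r` generators: the quotient of the free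
Lie algebra by the term of its lower central series spanned by the brackets of length `> k`
(Mathlib's lower central series starts with the whole algebra at index `0`). -/
abbrev FreeNilpotentLieAlgebra (r k : ℕ) : Type _ :=
  FreeLieAlgebra R (Fin r) ⧸
    LieModule.lowerCentralSeries R (FreeLieAlgebra R (Fin r)) (FreeLieAlgebra R (Fin r)) k

/-- The canonical grading of `𝔉_{r,k}`: the component of degree `-m` is spanned by the classes of
the iterated brackets of `m` generators. -/
noncomputable def freeNilpotentGrading (r k : ℕ) (j : ℤ) : Submodule R (FreeNilpotentLieAlgebra R r k) :=
  Submodule.span R {z | ∃ (m : ℕ) (x : FreeLieAlgebra R (Fin r)),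
    IsLieMonomial R m x ∧ j = -(m : ℤ) ∧ LieSubmodule.Quotient.mk x = z}

end FreeNilpotent

/-! ### The grading of a simple Lie algebra associated to a set of simple roots -/

section RootGrading

variable {L : Type*} [LieRing L] [LieAlgebra ℂ L] [FiniteDimensional ℂ L] [LieAlgebra.IsSimple ℂ L]
  {H : LieSubalgebra ℂ L} [H.IsCartanSubalgebra]

/-- The height with respect to a set `S` of simple roots, `ht_S (∑ aᵢ αᵢ) = ∑_{αᵢ ∈ S} aᵢ`, as a
linear functional on the dual of the Cartan subalgebra. -/
noncomputable def heightWrt (b : (LieAlgebra.IsKilling.rootSystem H).Base) (S : Finset b.support) :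
    Dual ℂ H →ₗ[ℂ] ℂ :=
  ∑ s ∈ S, b.toWeightBasis.coord s

/-- The grading associated to a set `S` of simple roots: the component of degree `j` is the sum of
the root spaces `L_χ` over all `χ` with `ht_S χ = j`. Here `L_χ = 0` unless `χ` is a root or
`χ = 0`, and `L_0 = H`, so that `H` lies in degree `0`. -/
noncomputable def rootGrading (b : (LieAlgebra.IsKilling.rootSystem H).Base) (S : Finset b.support)
    (j : ℤ) : Submodule ℂ L :=
  ⨆ (χ : Dual ℂ H) (_ : heightWrt b S χ = (j : ℂ)),
    (LieAlgebra.rootSpace H (χ : H → ℂ)).toSubmodule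

instance rootGrading_gradedBracket (b : (LieAlgebra.IsKilling.rootSystem H).Base)
    (S : Finset b.support) : SetLike.GradedBracket (rootGrading b S) where
  bracket_mem := by
    intro i j x y hx hy
    have key : ∀ χ : Dual ℂ H, heightWrt b S χ = (i : ℂ) → ∀ u ∈ LieAlgebra.rootSpace H (χ : H → ℂ),
        ∀ v ∈ rootGrading b S j, ⁅u, v⁆ ∈ rootGrading b S (i + j) := by
      intro χ hχ u hu
      suffices h : rootGrading b S j ≤
          (rootGrading b S (i + j)).comap (LieAlgebra.ad ℂ L u : L →ₗ[ℂ] L) by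
        intro v hv
        exact h hv
      refine iSup₂_le fun ψ hψ w hw => ?_
      refine Submodule.mem_iSup_of_mem (χ + ψ) (Submodule.mem_iSup_of_mem ?_ ?_)
      · rw [map_add, hχ, hψ]
        push_cast
        ring
      · exact LieAlgebra.lie_mem_genWeightSpace_of_mem_genWeightSpace hu hw
    have h : rootGrading b S i ≤
        (rootGrading b S (i + j)).comap (LieAlgebra.ad ℂ L y : L →ₗ[ℂ] L) := by
      refine iSup₂_le fun χ hχ w hw => ?_
      have := key χ hχ w hw y hy
      rw [← lie_skew, neg_mem_iff] at this
      exact this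
    have := h hx
    rw [Submodule.mem_comap, LieAlgebra.ad_apply, ← lie_skew, neg_mem_iff] at this
    exact this

/-- `α` enumerates the simple roots of the base `b` as `α₁, …, αₙ` (with `αᵢ₊₁ = α i`) in such a way
that their Cartan matrix is that of type `Dₙ`: the chain `α₁ - α₂ - ⋯ - αₙ₋₂` with both `αₙ₋₁` and
`αₙ` attached to `αₙ₋₂`. -/
def IsTypeD (n : ℕ) (b : (LieAlgebra.IsKilling.rootSystem H).Base) (α : Fin n ≃ b.support) : Prop :=
  ∀ i j : Fin n, b.cartanMatrix (α i) (α j) = CartanMatrix.D n i j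

end RootGrading

/-! The obstruction lies in the bracket of two elements of degree `-1`. In a free nilpotent Lie
algebra of step at least two, `Λ² 𝔣₋₁ → 𝔣₋₂` is injective, so commuting elements of degree `-1` are
proportional (`not_linearIndependent_of_lie_eq_zero`, tested by maps to the Heisenberg algebra). In
`𝔫₋₁` this fails: if `γ ∈ Σ` and `δ ∉ Σ` are joined by a simple bond, then `-γ` and `-(γ + δ)` are
roots of degree `-1`, and their root vectors commute because `2γ + δ` is not a root
(`exists_linearIndependent_lie_eq_zero`). For each listed `Σ` the diagram `Dₙ` has such a bond. -/

/-! ### Commuting elements of degree `-1` in a free nilpotent Lie algebra -/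

section Heisenberg

variable (K : Type*) [Field K]

/-- The three-dimensional Heisenberg Lie algebra: triples with
`⁅(a, b, c), (a', b', c')⁆ = (0, 0, a * b' - a' * b)`. -/
def Heisenberg : Type _ := K × K × K

namespace Heisenberg

instance : AddCommGroup (Heisenberg K) := inferInstanceAs (AddCommGroup (K × K × K))

instance : Module K (Heisenberg K) := inferInstanceAs (Module K (K × K × K))

instance : Bracket (Heisenberg K) (Heisenberg K) where
  bracket x y := (0, 0, x.1 * y.2.1 - y.1 * x.2.1)

variable {K}

@[simp] lemma fst_lie (x y : Heisenberg K) : ⁅x, y⁆.1 = 0 := rfl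
@[simp] lemma snd_fst_lie (x y : Heisenberg K) : ⁅x, y⁆.2.1 = 0 := rfl
@[simp] lemma snd_snd_lie (x y : Heisenberg K) : ⁅x, y⁆.2.2 = x.1 * y.2.1 - y.1 * x.2.1 := rfl
@[simp] lemma fst_add (x y : Heisenberg K) : (x + y).1 = x.1 + y.1 := rfl
@[simp] lemma snd_fst_add (x y : Heisenberg K) : (x + y).2.1 = x.2.1 + y.2.1 := rfl
@[simp] lemma snd_snd_add (x y : Heisenberg K) : (x + y).2.2 = x.2.2 + y.2.2 := rfl
@[simp] lemma fst_smul (t : K) (x : Heisenberg K) : (t • x).1 = t * x.1 := rfl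
@[simp] lemma snd_fst_smul (t : K) (x : Heisenberg K) : (t • x).2.1 = t * x.2.1 := rfl
@[simp] lemma snd_snd_smul (t : K) (x : Heisenberg K) : (t • x).2.2 = t * x.2.2 := rfl
@[simp] lemma fst_zero : (0 : Heisenberg K).1 = 0 := rfl
@[simp] lemma snd_fst_zero : (0 : Heisenberg K).2.1 = 0 := rfl
@[simp] lemma snd_snd_zero : (0 : Heisenberg K).2.2 = 0 := rfl

omit [Field K] in
lemma ext {x y : Heisenberg K} (h₁ : x.1 = y.1) (h₂ : x.2.1 = y.2.1) (h₃ : x.2.2 = y.2.2) :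
    x = y :=
  Prod.ext h₁ (Prod.ext h₂ h₃)

variable (K)

instance : LieRing (Heisenberg K) where
  add_lie x y z := by apply ext <;> (simp; try ring)
  lie_add x y z := by apply ext <;> (simp; try ring)
  lie_self x := by apply ext <;> simp
  leibniz_lie x y z := by apply ext <;> simp

instance : LieAlgebra K (Heisenberg K) where
  lie_smul t x y := by apply ext <;> (simp; try ring)

/-- Brackets have only a last coordinate, which the bracket ignores, so they are central. Hence
every homomorphism from a free Lie algebra to `Heisenberg K` kills the brackets of length at least
three. -/
lemma lowerCentralSeries_two_eq_bot :
    LieModule.lowerCentralSeries K (Heisenberg K) (Heisenberg K) 2 = ⊥ := by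
  have h₁ : LieModule.lowerCentralSeries K (Heisenberg K) (Heisenberg K) 1 ≤
      LieAlgebra.center K (Heisenberg K) := by
    rw [LieModule.lowerCentralSeries_succ, LieSubmodule.lie_le_iff]
    intro x _ y _
    rw [LieModule.mem_maxTrivSubmodule]
    intro z
    apply ext <;> simp
  rw [LieModule.lowerCentralSeries_succ, eq_bot_iff, LieSubmodule.lie_le_iff]
  intro x _ y hy
  rw [LieSubmodule.mem_bot]
  exact (LieModule.mem_maxTrivSubmodule K _ _ _).mp (h₁ hy) x

end Heisenberg

end Heisenberg

/-! ### Degree `-1` of the free nilpotent Lie algebra. -/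

section FreeNilpotentDegreeOne

lemma IsLieMonomial.pos {R : Type*} [CommRing R] {X : Type*} {m : ℕ} {x : FreeLieAlgebra R X}
    (h : IsLieMonomial R m x) : 0 < m := by
  induction h with
  | of i => exact Nat.one_pos
  | lie _ _ hm _ => omega

lemma IsLieMonomial.exists_eq_of {R : Type*} [CommRing R] {X : Type*} {x : FreeLieAlgebra R X}
    (h : IsLieMonomial R 1 x) : ∃ i, x = FreeLieAlgebra.of R i := by
  generalize hm : 1 = m at h
  cases h with
  | of i => exact ⟨i, rfl⟩
  | lie hx hy =>
    have := hx.pos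
    have := hy.pos
    omega

lemma exists_eq_mk_sum_of_mem_freeNilpotentGrading_neg_one {R : Type*} [CommRing R] {r k : ℕ}
    {x : FreeNilpotentLieAlgebra R r k} (hx : x ∈ freeNilpotentGrading R r k (-1)) :
    ∃ a : Fin r → R, x = LieSubmodule.Quotient.mk (∑ i, a i • FreeLieAlgebra.of R i) := by
  induction hx using Submodule.span_induction with
  | mem z hz =>
    obtain ⟨m, u, hu, hm, rfl⟩ := hz
    obtain rfl : m = 1 := by omega
    obtain ⟨i, rfl⟩ := hu.exists_eq_of
    exact ⟨Pi.single i 1, by simp [Pi.single_apply, ite_smul]⟩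
  | zero => exact ⟨0, by simp⟩
  | add y z _ _ hy hz =>
    obtain ⟨a, rfl⟩ := hy
    obtain ⟨c, rfl⟩ := hz
    exact ⟨a + c, by simp [add_smul, Finset.sum_add_distrib]⟩
  | smul t y _ hy =>
    obtain ⟨a, rfl⟩ := hy
    refine ⟨t • a, ?_⟩
    simp only [Pi.smul_apply, smul_assoc, ← Finset.smul_sum]
    rfl

/-- Commuting elements of degree `-1` in a free nilpotent Lie algebra of step at least two are
proportional. -/
theorem not_linearIndependent_of_lie_eq_zero {K : Type*} [Field K] {r k : ℕ} (hk : 2 ≤ k)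
    {x y : FreeNilpotentLieAlgebra K r k} (hx : x ∈ freeNilpotentGrading K r k (-1))
    (hy : y ∈ freeNilpotentGrading K r k (-1)) (hxy : ⁅x, y⁆ = 0) :
    ¬ LinearIndependent K ![x, y] := by
  obtain ⟨a, rfl⟩ := exists_eq_mk_sum_of_mem_freeNilpotentGrading_neg_one hx
  obtain ⟨c, rfl⟩ := exists_eq_mk_sum_of_mem_freeNilpotentGrading_neg_one hy
  have hmem : ⁅∑ i, a i • FreeLieAlgebra.of K i, ∑ i, c i • FreeLieAlgebra.of K i⁆ ∈
      LieModule.lowerCentralSeries K (FreeLieAlgebra K (Fin r)) (FreeLieAlgebra K (Fin r)) k := by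
    rwa [← LieSubmodule.Quotient.mk_bracket, LieSubmodule.Quotient.mk_eq_zero'] at hxy
  -- All 2 × 2 minors of the coefficient vectors vanish. For `i ≠ j`, send generator `i` to `(1, 0,
  -- 0)`, generator `j` to `(0, 1, 0)` and the others to `0`: the last coordinate of the image of
  -- the bracket is the minor.
  have key : ∀ i j, a i * c j = c i * a j := by
    intro i j
    obtain rfl | hij := eq_or_ne i j
    · ring
    let f : FreeLieAlgebra K (Fin r) →ₗ⁅K⁆ Heisenberg K :=
      FreeLieAlgebra.lift K fun l =>
        ((Pi.single i 1 : Fin r → K) l, (Pi.single j 1 : Fin r → K) l, 0)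
    have hf : ∀ l, f (FreeLieAlgebra.of K l) =
        ((Pi.single i 1 : Fin r → K) l, (Pi.single j 1 : Fin r → K) l, 0) :=
      fun l => FreeLieAlgebra.lift_of_apply _ l
    have hp : ∀ (p : Heisenberg K →ₗ[K] K) (v : Fin r → K),
        p (f (∑ l, v l • FreeLieAlgebra.of K l)) = ∑ l, v l * p (f (FreeLieAlgebra.of K l)) := by
      intro p v
      simp only [map_sum, map_smul, smul_eq_mul]
    have hf₁ : ∀ v : Fin r → K, (f (∑ l, v l • FreeLieAlgebra.of K l)).1 = v i := by
      intro v
      refine (hp (LinearMap.fst K K (K × K)) v).trans ?_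
      simp_rw [hf]
      exact (Finset.sum_congr rfl fun l _ => by rfl).trans (dotProduct_single_one v i)
    have hf₂ : ∀ v : Fin r → K, (f (∑ l, v l • FreeLieAlgebra.of K l)).2.1 = v j := by
      intro v
      refine (hp (LinearMap.fst K K K ∘ₗ LinearMap.snd K K (K × K)) v).trans ?_
      simp_rw [hf]
      exact (Finset.sum_congr rfl fun l _ => by rfl).trans (dotProduct_single_one v j)
    have h := LieIdeal.map_lowerCentralSeries_le k (f := f) (LieIdeal.mem_map hmem)
    have h := LieModule.antitone_lowerCentralSeries K (Heisenberg K) (Heisenberg K) hk h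
    rw [Heisenberg.lowerCentralSeries_two_eq_bot, LieSubmodule.mem_bot, LieHom.map_lie] at h
    have h := congrArg (fun z : Heisenberg K => z.2.2) h
    simp only [Heisenberg.snd_snd_lie, hf₁, hf₂, Heisenberg.snd_snd_zero] at h
    exact sub_eq_zero.mp h
  intro hli
  have hc : c ≠ 0 := by
    rintro rfl
    exact hli.ne_zero 1 (by simp)
  obtain ⟨j, hj⟩ := Function.ne_iff.mp hc
  -- By the vanishing minors, `c j • x - a j • y = 0` is a relation, nontrivial since `c j ≠ 0`.
  refine hj (LinearIndependent.pair_iff.mp hli (c j) (-a j) ?_).1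
  change LieSubmodule.Quotient.mk (c j • (∑ i, a i • FreeLieAlgebra.of K i) +
    -a j • (∑ i, c i • FreeLieAlgebra.of K i)) = _
  rw [Finset.smul_sum, Finset.smul_sum, ← Finset.sum_add_distrib, Finset.sum_eq_zero]
  · rfl
  · intro i _
    rw [smul_smul, smul_smul, ← add_smul, mul_comm (c j), key i j]
    simp [mul_comm]

end FreeNilpotentDegreeOne

/-! ### The root string of a simple bond -/

section SimpleBond

namespace RootPairing.Base

variable {ι R M N : Type*} [Finite ι] [CommRing R] [CharZero R] [IsDomain R]
  [AddCommGroup M] [Module R M] [AddCommGroup N] [Module R N]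
  {P : RootPairing ι R M N} [P.IsCrystallographic] (b : P.Base) {i j : b.support}

/-- A difference of simple roots is not a root, so the `i`-string through `j` starts at `j` and its
length is minus the Cartan entry. -/
lemma chainTopCoeff_eq_one_of_cartanMatrix_eq_neg_one (hij : i ≠ j)
    (h : b.cartanMatrix j i = -1) : P.chainTopCoeff i j = 1 := by
  have := b.cartanMatrix_eq_neg_chainTopCoeff hij.symm
  omega

lemma root_add_mem_range_of_cartanMatrix_eq_neg_one (hij : i ≠ j)
    (h : b.cartanMatrix j i = -1) : P.root j + P.root i ∈ Set.range P.root := by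
  simpa using (P.root_add_nsmul_mem_range_iff_le_chainTopCoeff
    (b.linearIndependent_pair_of_ne hij) (n := 1)).mpr
    (b.chainTopCoeff_eq_one_of_cartanMatrix_eq_neg_one hij h).ge

lemma root_add_two_nsmul_notMem_range_of_cartanMatrix_eq_neg_one (hij : i ≠ j)
    (h : b.cartanMatrix j i = -1) : P.root j + 2 • P.root i ∉ Set.range P.root := by
  rw [P.root_add_nsmul_mem_range_iff_le_chainTopCoeff (b.linearIndependent_pair_of_ne hij),
    b.chainTopCoeff_eq_one_of_cartanMatrix_eq_neg_one hij h]
  norm_num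

end RootPairing.Base

end SimpleBond

/-! ### Commuting root vectors of degree `-1` -/

section RootVectors

variable {L : Type*} [LieRing L] [LieAlgebra ℂ L] [FiniteDimensional ℂ L] [LieAlgebra.IsSimple ℂ L]
  {H : LieSubalgebra ℂ L} [H.IsCartanSubalgebra]

open LieAlgebra.IsKilling

lemma exists_mem_rootSpace_ne_zero {χ : Dual ℂ H} (hχ : χ ∈ Set.range (rootSystem H).root) :
    ∃ x ∈ LieAlgebra.rootSpace H (χ : H → ℂ), x ≠ 0 := by
  obtain ⟨k, rfl⟩ := hχ
  exact k.1.exists_ne_zero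

/-- The case `χ = 0` must be excluded because its root space is `H`. -/
lemma rootSpace_eq_bot_of_notMem_range_root {χ : Dual ℂ H} (h₀ : χ ≠ 0)
    (hχ : χ ∉ Set.range (rootSystem H).root) : LieAlgebra.rootSpace H (χ : H → ℂ) = ⊥ := by
  by_contra h
  let w : LieModule.Weight ℂ H L := ⟨χ, h⟩
  have hw : w.IsNonZero := fun hz => h₀ (LinearMap.ext fun x => congrFun hz x)
  exact hχ ⟨⟨w, by simpa using hw⟩, by ext; rfl⟩

variable (b : (rootSystem H).Base)

open scoped Classical in
lemma heightWrt_root (S : Finset b.support) (i : b.support) :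
    heightWrt b S ((rootSystem H).root i) = if i ∈ S then 1 else 0 := by
  simp only [heightWrt, LinearMap.sum_apply, Basis.coord_apply, b.toWeightBasis_repr_root,
    Finsupp.single_apply, Finset.sum_ite_eq]

lemma rootSpace_le_rootGrading (S : Finset b.support) {χ : Dual ℂ H} {j : ℤ}
    (h : heightWrt b S χ = j) :
    (LieAlgebra.rootSpace H (χ : H → ℂ)).toSubmodule ≤ rootGrading b S j :=
  le_iSup₂_of_le χ h le_rfl

/-- If `γ ∈ S` and `δ ∉ S` are simple roots with `⟨δ, γ⟩ = -1`, then `-γ` and `-(γ + δ)` are roots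
of degree `-1` whose root vectors commute. -/
theorem exists_linearIndependent_lie_eq_zero (S : Finset b.support) {γ δ : b.support}
    (hγ : γ ∈ S) (hδ : δ ∉ S) (h : b.cartanMatrix δ γ = -1) :
    ∃ x ∈ rootGrading b S (-1), ∃ y ∈ rootGrading b S (-1),
      LinearIndependent ℂ ![x, y] ∧ ⁅x, y⁆ = 0 := by
  have hne : γ ≠ δ := by rintro rfl; exact hδ hγ
  have hli := b.linearIndependent_pair_of_ne hne
  have hsum := b.root_add_mem_range_of_cartanMatrix_eq_neg_one hne h
  have hsum₂ := b.root_add_two_nsmul_notMem_range_of_cartanMatrix_eq_neg_one hne h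
  obtain ⟨x, hx, hx₀⟩ := exists_mem_rootSpace_ne_zero (χ := -(rootSystem H).root γ)
    ((rootSystem H).neg_mem_range_root_iff.mpr ⟨γ, rfl⟩)
  obtain ⟨y, hy, hy₀⟩ := exists_mem_rootSpace_ne_zero (χ := -((rootSystem H).root δ + (rootSystem H).root γ))
    ((rootSystem H).neg_mem_range_root_iff.mpr hsum)
  refine ⟨x, rootSpace_le_rootGrading b S ?_ hx, y, rootSpace_le_rootGrading b S ?_ hy, ?_, ?_⟩
  · rw [map_neg, heightWrt_root, if_pos hγ]
    simp
  · rw [map_neg, map_add, heightWrt_root, heightWrt_root, if_pos hγ, if_neg hδ]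
    simp
  -- The two weights differ by the nonzero root `δ`, so their root spaces are disjoint; in a linear
  -- relation, `s • x` lies in both.
  · have hw : ((-(rootSystem H).root γ : Dual ℂ H) : H → ℂ) ≠ (-((rootSystem H).root δ + (rootSystem H).root γ) : Dual ℂ H) := by
      intro he
      refine (rootSystem H).ne_zero δ ?_
      simpa [-rootSystem_root_apply] using DFunLike.coe_injective he
    have hd := LieModule.disjoint_genWeightSpace ℂ H L hw
    rw [LinearIndependent.pair_iff]
    intro s t hst
    have hs : s • x = 0 := by
      have h₁ : s • x ∈ LieAlgebra.rootSpace H ((-(rootSystem H).root γ : Dual ℂ H) : H → ℂ) :=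
        Submodule.smul_mem _ s hx
      have h₂ : s • x ∈ LieAlgebra.rootSpace H ((-((rootSystem H).root δ + (rootSystem H).root γ) : Dual ℂ H) : H → ℂ) := by
        rw [eq_neg_of_add_eq_zero_left hst]
        exact neg_mem (Submodule.smul_mem _ t hy)
      have := (LieSubmodule.disjoint_toSubmodule.mpr hd).le_bot ⟨h₁, h₂⟩
      simpa using this
    rw [hs, zero_add] at hst
    exact ⟨(smul_eq_zero.mp hs).resolve_right hx₀, (smul_eq_zero.mp hst).resolve_right hy₀⟩
  · have hmem : ⁅x, y⁆ ∈
        LieAlgebra.rootSpace H ((-(rootSystem H).root γ + -((rootSystem H).root δ + (rootSystem H).root γ) : Dual ℂ H) : H → ℂ) :=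
      LieAlgebra.lie_mem_genWeightSpace_of_mem_genWeightSpace hx hy
    have heq : -(rootSystem H).root γ + -((rootSystem H).root δ + (rootSystem H).root γ) = -((rootSystem H).root δ + 2 • (rootSystem H).root γ) := by module
    -- The bracket has weight `-(δ + 2γ)`, which is not a root, and is nonzero because `γ` and `δ`
    -- are linearly independent.
    rw [heq, rootSpace_eq_bot_of_notMem_range_root] at hmem
    · simpa using hmem
    · intro h₀
      have := LinearIndependent.pair_iff.mp hli 2 1 (by
        rw [neg_eq_zero] at h₀
        rw [← h₀]
        module)
      exact one_ne_zero this.2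
    · rwa [(rootSystem H).neg_mem_range_root_iff]

/-- A graded isomorphism with a free nilpotent Lie algebra of step at least two is excluded by a
simple root in `S` with a neighbour outside `S` attached to it by a simple bond. -/
theorem not_exists_isGradedIso (S : Finset b.support) {γ δ : b.support}
    (hγ : γ ∈ S) (hδ : δ ∉ S) (h : b.cartanMatrix δ γ = -1) (r : ℕ) {k : ℕ} (hk : 2 ≤ k) :
    ¬ ∃ φ : FreeNilpotentLieAlgebra ℂ r k ≃ₗ⁅ℂ⁆ negativePart (rootGrading b S),
      IsGradedIso (freeNilpotentGrading ℂ r k) (negativeGrading (rootGrading b S)) φ := by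
  rintro ⟨φ, hφ⟩
  obtain ⟨x, hx, y, hy, hli, hxy⟩ := exists_linearIndependent_lie_eq_zero b S hγ hδ h
  have hle : rootGrading b S (-1) ≤ (negativePart (rootGrading b S)).toSubmodule :=
    le_iSup₂_of_le (-1) (by norm_num) le_rfl
  have hx' : (⟨x, hle hx⟩ : negativePart (rootGrading b S)) ∈
      negativeGrading (rootGrading b S) (-1) := hx
  have hy' : (⟨y, hle hy⟩ : negativePart (rootGrading b S)) ∈
      negativeGrading (rootGrading b S) (-1) := hy
  -- Since `φ` maps degree `-1` onto degree `-1`, the commuting pair pulls back to degree `-1` of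
  -- the free side.
  rw [← hφ] at hx' hy'
  obtain ⟨u, hu, hux⟩ := hx'
  obtain ⟨v, hv, hvy⟩ := hy'
  have hux : φ u = ⟨x, hle hx⟩ := hux
  have hvy : φ v = ⟨y, hle hy⟩ := hvy
  refine not_linearIndependent_of_lie_eq_zero hk hu hv ?_ ?_
  · apply φ.injective
    change φ ⁅u, v⁆ = φ 0
    rw [LieEquiv.map_lie, hux, hvy, map_zero]
    exact Subtype.ext hxy
  · rw [LinearIndependent.pair_iff] at hli ⊢
    intro s t hst
    apply hli s t
    have h := congrArg (fun z => (φ z : L)) hst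
    simpa [hux, hvy] using h

end RootVectors

/-! ### The listed sets of simple roots in type `Dₙ`. -/

theorem mainTheorem7 {L : Type*} [LieRing L] [LieAlgebra ℂ L] [FiniteDimensional ℂ L]
    [LieAlgebra.IsSimple ℂ L] (H : LieSubalgebra ℂ L) [H.IsCartanSubalgebra]
    (b : (LieAlgebra.IsKilling.rootSystem H).Base)
    (n : ℕ) (hn : 4 ≤ n) (α : Fin n ≃ b.support) (hα : IsTypeD n b α)
    (S : Finset (Fin n))
    (hS : (∃ i : Fin n, 2 ≤ i.val + 1 ∧ i.val + 1 ≤ n - 2 ∧ S = {⟨0, by omega⟩, i}) ∨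
      (∃ i : Fin n, 2 ≤ i.val + 1 ∧ i.val + 1 ≤ n - 2 ∧ S = {i, ⟨n - 1, by omega⟩}) ∨
      (∃ i : Fin n, 2 ≤ i.val + 1 ∧ i.val + 1 ≤ n - 2 ∧ S = {i, ⟨n - 2, by omega⟩}) ∨
      S = {⟨0, by omega⟩, ⟨n - 2, by omega⟩, ⟨n - 1, by omega⟩})
    (r : ℕ) :
    ¬ ∃ φ : FreeNilpotentLieAlgebra ℂ r 3 ≃ₗ⁅ℂ⁆
        negativePart (rootGrading b (S.map α.toEmbedding)),
      IsGradedIso (freeNilpotentGrading ℂ r 3)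
        (negativeGrading (rootGrading b (S.map α.toEmbedding))) φ := by
  suffices h : ∃ i j : Fin n, i ∈ S ∧ j ∉ S ∧ CartanMatrix.D n j i = -1 by
    obtain ⟨i, j, hi, hj, hij⟩ := h
    exact not_exists_isGradedIso b _ (γ := α i) (δ := α j) (by simpa using hi) (by simpa using hj)
      ((hα j i).trans hij) r (by norm_num)
  rcases hS with ⟨i, h₁, h₂, rfl⟩ | ⟨i, h₁, h₂, rfl⟩ | ⟨i, h₁, h₂, rfl⟩ | rfl
  -- For `{α₁, αᵢ}` the neighbour after `αᵢ` is taken, as the one before may be `α₁`. At the end of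
  -- the range this is the bond from `αₙ₋₂` to `αₙ₋₁`.
  · refine ⟨i, ⟨i + 1, by omega⟩, by simp, by simp [Fin.ext_iff], ?_⟩
    simp only [CartanMatrix.D, Matrix.of_apply, Fin.ext_iff]
    grind
  -- Here and in the next case the neighbour before `αᵢ` exists since `i ≥ 2` in the numbering from
  -- `1`, and it avoids the fork at the end.
  · refine ⟨i, ⟨i - 1, by omega⟩, by simp, ?_, ?_⟩
    · simp only [Finset.mem_insert, Finset.mem_singleton, Fin.ext_iff]
      omega
    · simp only [CartanMatrix.D, Matrix.of_apply, Fin.ext_iff]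
      grind
  · refine ⟨i, ⟨i - 1, by omega⟩, by simp, ?_, ?_⟩
    · simp only [Finset.mem_insert, Finset.mem_singleton, Fin.ext_iff]
      omega
    · simp only [CartanMatrix.D, Matrix.of_apply, Fin.ext_iff]
      grind
  -- The bond from `α₁` to `α₂` serves: `α₂` differs from `αₙ₋₁` because `n ≥ 4`.
  · refine ⟨⟨0, by omega⟩, ⟨1, by omega⟩, by simp, ?_, ?_⟩
    · simp only [Finset.mem_insert, Finset.mem_singleton, Fin.ext_iff]
      omega
    · simp only [CartanMatrix.D, Matrix.of_apply, Fin.ext_iff]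
      grind
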